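/- Let $\mathbb G$ be a connected undirected (simple) graph on the nodes $\{1,\dots,N\}$, let $\mathbb N_n$ be the set of neighbours of node $n$, and let $x_1,\dots,x_N\in\mathbb R$ be fixed measurements, $x_n$ held by node $n$. Put $u(t)=1$ if $t\ge 0$ and $u(t)=0$ otherwise, $\widehat F(w)=\frac1N\sum_{n=1}^N u(w-x_n)$, and, for a given $0<p<1$ with $p\notin\{\frac1N,\frac2N,\dots,1\}$, let $\theta_p=\inf\{w\in\mathbb R:\widehat F(w)\ge p\}$ be the empirical $p$-quantile. Let $$\alpha(i)=\frac{\alpha_0}{(i+1)^{\tau_1}},\qquad \eta(i)=\frac{\eta_0}{(i+1)^{\tau_2}},\qquad i\ge 0,$$ with $\alpha_0,\eta_0>0$, $1\ge\tau_1>\tau_2>0.5$ and $\tau_1-\tau_2<0.5$. For every node $n$ and every $l\in\mathbb N_n$ let the noise on the link from $l$ to $n$ be a real random process $\{\xi_{nl}(i)\}_{i\ge0}$ that is independent and identically distributed in $i$ with mean zero, where $\sup_{n,l,i}E[\xi_{nl}(i)^2]<\infty$ (no independence between different links is required). Let the states be given by $\omega_n(0)=x_n$ and, for $i\ge0$ and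 all $n$, $$\psi_n(i)=\omega_n(i)-\alpha(i)\big[u(\omega_n(i)-x_n)-p\big],\qquad \omega_n(i+1)=\psi_n(i)-\eta(i)\sum_{l\in\mathbb N_n}\big[\psi_n(i)-(\psi_l(i)+\xi_{nl}(i))\big];$$ in vector form, $\boldsymbol\omega(i+1)=(\mathbf I-\eta(i)\mathbf L)(\boldsymbol\omega(i)-\alpha(i)\mathbf y(i))-\eta(i)\boldsymbol\xi(i)$, where $\mathbf L$ is the graph Laplacian, $y_n(i)=u(\omega_n(i)-x_n)-p$ and $\xi_n(i)=-\sum_{l\in\mathbb N_n}\xi_{nl}(i)$. Then every $\omega_n(i)$ is integrable and $$\lim_{i\to\infty}E[\omega_n(i)]=\theta_p\qquad\text{for every } 1\le n\le N.$$ -/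

import Mathlib

open MeasureTheory ProbabilityTheory Filter Topology

namespace DistQuantile

noncomputable section

/-- The step function `u(t) = 1` for `t ≥ 0` and `u(t) = 0` otherwise. -/
def step (t : ℝ) : ℝ := if 0 ≤ t then 1 else 0

/-- The empirical distribution function of the measurements `x 0, …, x (N - 1)`. -/
def ecdf {N : ℕ} (x : Fin N → ℝ) (w : ℝ) : ℝ := (1 / (N : ℝ)) * ∑ n, step (w - x n)

/-- The empirical `p`-quantile, `inf {w | F(w; x) ≥ p}`. -/
def quantile {N : ℕ} (x : Fin N → ℝ) (p : ℝ) : ℝ := sInf {w : ℝ | p ≤ ecdf x w}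

/-- The step-size sequence `c / (i + 1) ^ τ`, `i = 0, 1, 2, …`. -/
def stepSize (c τ : ℝ) (i : ℕ) : ℝ := c / ((i : ℝ) + 1) ^ τ

/-- The local update with gain `a`: from the states `w`, the intermediate states `ψ`. -/
def localUpdate {N : ℕ} (x : Fin N → ℝ) (p a : ℝ) (w : Fin N → ℝ) (n : Fin N) : ℝ :=
  w n - a * (step (w n - x n) - p)

/-- The averaging step with gain `b`: node `n` receives `ψ l + z n l` from its neighbour `l`,
where `z n l` is the noise on the link from `l` to `n`. -/
def averaging {N : ℕ} (G : SimpleGraph (Fin N)) [DecidableRel G.Adj] (b : ℝ)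
    (z : Fin N → Fin N → ℝ) (ψ : Fin N → ℝ) (n : Fin N) : ℝ :=
  ψ n - b * ∑ l ∈ G.neighborFinset n, (ψ n - (ψ l + z n l))

/-- The state vector at time `i` along a realization `z` of the link noise, where `z n l i` is the
noise at time `i` on the link from `l` to `n`. Every node starts from its own measurement. -/
def state {N : ℕ} (G : SimpleGraph (Fin N)) [DecidableRel G.Adj] (x : Fin N → ℝ) (p : ℝ)
    (α η : ℕ → ℝ) (z : Fin N → Fin N → ℕ → ℝ) : ℕ → Fin N → ℝ
  | 0 => x
  | i + 1 => averaging G (η i) (fun n l => z n l i)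
      (localUpdate x p (α i) (state G x p α η z i))

/-- The recursion in vector form,
`ω(i+1) = (I - η(i) L) (ω(i) - α(i) y(i)) - η(i) ξ(i)` with `L` the graph Laplacian,
`y_n(i) = u(ω_n(i) - x_n) - p` and `ξ_n(i) = - ∑_{l ∈ N_n} ξ_{nl}(i)`. -/
theorem state_succ {N : ℕ} (G : SimpleGraph (Fin N)) [DecidableRel G.Adj] (x : Fin N → ℝ)
    (p : ℝ) (α η : ℕ → ℝ) (z : Fin N → Fin N → ℕ → ℝ) (i : ℕ) :
    state G x p α η z (i + 1) =
      Matrix.mulVec (1 - η i • G.lapMatrix ℝ)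
          (state G x p α η z i - α i • fun n => step (state G x p α η z i n - x n) - p)
        - η i • fun n => -∑ l ∈ G.neighborFinset n, z n l i := by
  have hψ : (state G x p α η z i - α i • fun n => step (state G x p α η z i n - x n) - p)
      = localUpdate x p (α i) (state G x p α η z i) := by
    funext n
    simp [localUpdate]
  rw [hψ]
  funext n
  simp only [state, averaging, Matrix.sub_mulVec, Matrix.one_mulVec, Matrix.smul_mulVec,
    Pi.sub_apply, Pi.smul_apply, SimpleGraph.lapMatrix_mulVec_apply, smul_eq_mul,
    Finset.sum_sub_distrib, Finset.sum_add_distrib, Finset.sum_const,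
    SimpleGraph.card_neighborFinset_eq_degree, nsmul_eq_mul]
  ring

end

end DistQuantile

/-! Averaging with the Laplacian `L` preserves the mean of the nodes and contracts deviations from
it. The noise is handled by a change of variable: adding to the state the accumulated noise minus
its limit `S` gives `denoised`, which obeys the noiseless averaging recursion up to a forcing `η(i)
L T(i)`, where `T(i)`, accumulated noise minus `S`, tends to zero and `L T(i)` has mean zero.

The disagreement contracts by `1 - c η(i)` against an input of order `α(i) + η(i) ‖T(i)‖`; it
vanishes because `α/η → 0`, `T → 0` and `∑ η = ∞` (`tendsto_norm_centered`). All nodes then lie near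
the mean of `denoised`, so the drift of that mean is squeezed between values of `ecdf x - p` at
nearby points. As `p` is not a multiple of `1/N`, this drift stays away from zero off the quantile
and has the right sign (`exists_ecdf_gap`), and `∑ α = ∞` forces convergence. This argument is
pathwise (`tendsto_state`).

On each link the sums `∑ η(j) ξ(j)` form an `L²`-bounded martingale, since `∑ η² < ∞`: they converge
almost surely, and the maximal inequality gives them an integrable dominating variable. The states
are at most `K (1 + B)` with `K` deterministic and `B` a bound for these sums
(`exists_abs_state_le`), so dominated convergence passes to expectations. -/

namespace DistQuantile

/-! ### Scalar recursions -/

/-- A contracting recursion with a bounded input stays bounded. -/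
theorem le_max_of_contracting {a η b : ℕ → ℝ} {c β : ℝ} {i₀ : ℕ} (hc : 0 < c)
    (hη : ∀ i, 0 ≤ η i) (hcη : ∀ i, i₀ ≤ i → c * η i ≤ 1)
    (ha : ∀ i, i₀ ≤ i → a (i + 1) ≤ (1 - c * η i) * a i + η i * b i)
    (hb : ∀ i, i₀ ≤ i → b i ≤ β) (i : ℕ) (hi : i₀ ≤ i) : a i ≤ max (a i₀) (β / c) := by
  induction i, hi using Nat.le_induction with
  | base => exact le_max_left _ _
  | succ i hi ih =>
    set K := max (a i₀) (β / c)
    have hK : β ≤ c * K := by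
      have : β / c ≤ K := le_max_right _ _
      rwa [div_le_iff₀' hc] at this
    have h1 := mul_le_mul_of_nonneg_left ih (sub_nonneg.2 (hcη i hi))
    have h2 := mul_le_mul_of_nonneg_left ((hb i hi).trans hK) (hη i)
    linarith [ha i hi]

/-- A contracting recursion whose input tends to zero tends to zero. -/
theorem tendsto_zero_of_contracting {a η b : ℕ → ℝ} {c : ℝ} (hc : 0 < c)
    (hη : ∀ i, 0 ≤ η i) (hcη : ∀ᶠ i in atTop, c * η i ≤ 1)
    (hsum : Tendsto (fun n => ∑ i ∈ Finset.range n, η i) atTop atTop) (ha0 : ∀ i, 0 ≤ a i)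
    (ha : ∀ᶠ i in atTop, a (i + 1) ≤ (1 - c * η i) * a i + η i * b i)
    (hb : Tendsto b atTop (𝓝 0)) : Tendsto a atTop (𝓝 0) := by
  rw [Metric.tendsto_nhds]
  intro ε hε
  -- With this bound on the input, `a - ε / 2` satisfies the homogeneous contraction.
  have hb' : ∀ᶠ i in atTop, b i < c * (ε / 2) := hb.eventually_lt_const (by positivity)
  obtain ⟨i₀, h0⟩ := eventually_atTop.1 (hcη.and (ha.and hb'))
  set D := max (a i₀ - ε / 2) 0
  have key : ∀ i, i₀ ≤ i → a i - ε / 2 ≤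
      Real.exp (-(c * (∑ j ∈ Finset.range i, η j - ∑ j ∈ Finset.range i₀, η j))) * D := by
    intro i hi
    induction i, hi using Nat.le_induction with
    | base => simp [D]
    | succ i hi ih =>
      obtain ⟨h1, h2, h3⟩ := h0 i hi
      have e : Real.exp (-(c * (∑ j ∈ Finset.range (i + 1), η j - ∑ j ∈ Finset.range i₀, η j)))
          = Real.exp (-(c * η i)) *
            Real.exp (-(c * (∑ j ∈ Finset.range i, η j - ∑ j ∈ Finset.range i₀, η j))) := by
        rw [← Real.exp_add, Finset.sum_range_succ]; ring_nf
      have h4 : 1 - c * η i ≤ Real.exp (-(c * η i)) := by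
        linarith [Real.add_one_le_exp (-(c * η i))]
      have h5 : 0 ≤ Real.exp (-(c * (∑ j ∈ Finset.range i, η j - ∑ j ∈ Finset.range i₀, η j))) * D :=
        mul_nonneg (Real.exp_pos _).le (le_max_right _ _)
      rw [e, mul_assoc]
      have h6 := mul_le_mul_of_nonneg_right h4 h5
      have h7 := mul_le_mul_of_nonneg_left ih (sub_nonneg.2 h1)
      have h8 := mul_le_mul_of_nonneg_left h3.le (hη i)
      linarith
  have hlim : Tendsto (fun i => Real.exp (-(c * (∑ j ∈ Finset.range i, η j
      - ∑ j ∈ Finset.range i₀, η j))) * D) atTop (𝓝 0) := by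
    have : Tendsto (fun i => Real.exp (-(c * (∑ j ∈ Finset.range i, η j
      - ∑ j ∈ Finset.range i₀, η j)))) atTop (𝓝 0) :=
      Real.tendsto_exp_neg_atTop_nhds_zero.comp
        ((tendsto_atTop_add_const_right _ _ hsum).const_mul_atTop hc)
    simpa using this.mul_const D
  filter_upwards [eventually_ge_atTop i₀, hlim.eventually_lt_const (half_pos hε)] with i h1 h2
  rw [Real.dist_eq, sub_zero, abs_of_nonneg (ha0 i)]
  linarith [key i h1]

/-- Above `ε` each step removes at least `c * α i`, so divergence of `∑ α` brings the sequence below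
`2 * ε`. It stays there: from below `ε` one step rises by at most `α i < ε`, and from above `ε` it
descends. -/
theorem eventually_le_of_drift {v g α : ℕ → ℝ} {c : ℝ} (hc : 0 < c) (hα : ∀ i, 0 ≤ α i)
    (hα0 : Tendsto α atTop (𝓝 0))
    (hsum : Tendsto (fun n => ∑ i ∈ Finset.range n, α i) atTop atTop)
    (hv : ∀ i, v (i + 1) = v i - α i * g i) (hg : ∀ i, -1 ≤ g i) {ε : ℝ} (hε : 0 < ε)
    (hd : ∀ᶠ i in atTop, ε ≤ v i → c ≤ g i) : ∀ᶠ i in atTop, v i ≤ 2 * ε := by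
  obtain ⟨i₀, h0⟩ := eventually_atTop.1 (hd.and (hα0.eventually_lt_const hε))
  have stay : ∀ i, i₀ ≤ i → v i ≤ 2 * ε → v (i + 1) ≤ 2 * ε := by
    intro i hi h
    obtain ⟨h1, h2⟩ := h0 i hi
    rw [hv]
    rcases le_or_gt ε (v i) with h3 | h3
    · nlinarith [mul_nonneg (hα i) (hc.le.trans (h1 h3))]
    · nlinarith [mul_nonneg (hα i) (sub_nonneg.2 (hg i))]
  have hit : ∃ i, i₀ ≤ i ∧ v i ≤ 2 * ε := by
    by_contra! hcon
    have dec : ∀ i, i₀ ≤ i →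
        v i ≤ v i₀ - c * (∑ j ∈ Finset.range i, α j - ∑ j ∈ Finset.range i₀, α j) := by
      intro i hi
      induction i, hi using Nat.le_induction with
      | base => simp
      | succ i hi ih =>
        have h1 := (h0 i hi).1 (by linarith [hcon i hi])
        rw [hv, Finset.sum_range_succ]
        have := mul_le_mul_of_nonneg_left h1 (hα i)
        linarith
    have hlim : Tendsto (fun i => c * (∑ j ∈ Finset.range i, α j
        - ∑ j ∈ Finset.range i₀, α j)) atTop atTop :=
      (tendsto_atTop_add_const_right _ _ hsum).const_mul_atTop hc
    obtain ⟨i, h1, h2⟩ := ((eventually_ge_atTop i₀).and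
      (hlim.eventually_gt_atTop (v i₀))).exists
    linarith [dec i h1, hcon i h1]
  obtain ⟨i₁, h1, h2⟩ := hit
  filter_upwards [eventually_ge_atTop i₁] with i hi
  induction i, hi using Nat.le_induction with
  | base => exact h2
  | succ i hi ih => exact stay i (h1.trans hi) ih

/-- A recursion with bounded drift, bounded away from zero and pointing towards `θ` outside every
neighbourhood of `θ`, converges to `θ`. -/
theorem tendsto_of_drift {v g α : ℕ → ℝ} {c θ : ℝ} (hc : 0 < c) (hα : ∀ i, 0 ≤ α i)
    (hα0 : Tendsto α atTop (𝓝 0))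
    (hsum : Tendsto (fun n => ∑ i ∈ Finset.range n, α i) atTop atTop)
    (hv : ∀ i, v (i + 1) = v i - α i * g i) (hg : ∀ i, |g i| ≤ 1)
    (hup : ∀ ε > 0, ∀ᶠ i in atTop, θ + ε ≤ v i → c ≤ g i)
    (hdown : ∀ ε > 0, ∀ᶠ i in atTop, v i ≤ θ - ε → g i ≤ -c) : Tendsto v atTop (𝓝 θ) := by
  rw [Metric.tendsto_nhds]
  intro ε hε
  have hε' : 0 < ε / 4 := by positivity
  have h1 := eventually_le_of_drift (v := fun i => v i - θ) (g := g) hc hα hα0 hsum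
    (fun i => by rw [hv]; ring) (fun i => (abs_le.1 (hg i)).1) hε'
    ((hup _ hε').mono fun i h h' => h (by linarith))
  have h2 := eventually_le_of_drift (v := fun i => θ - v i) (g := fun i => -g i) hc hα hα0 hsum
    (fun i => by rw [hv]; ring) (fun i => by linarith [(abs_le.1 (hg i)).2]) hε'
    ((hdown _ hε').mono fun i h h' => by linarith [h (by linarith)])
  filter_upwards [h1, h2] with i h1 h2
  rw [Real.dist_eq, abs_lt]
  constructor <;> linarith

/-- A recursion with bounded drift that points towards `θ` outside a ball of radius `R` stays
in a ball around `θ`. -/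
theorem abs_sub_le_of_drift {v g α : ℕ → ℝ} {θ R A : ℝ} (hα : ∀ i, 0 ≤ α i) (hαA : ∀ i, α i ≤ A)
    (hR : 0 ≤ R) (hv : ∀ i, v (i + 1) = v i - α i * g i) (hg : ∀ i, |g i| ≤ 1)
    (hup : ∀ i, θ + R < v i → 0 ≤ g i) (hdown : ∀ i, v i < θ - R → g i ≤ 0) (i : ℕ) :
    |v i - θ| ≤ |v 0 - θ| + R + A := by
  have hA : 0 ≤ A := (hα 0).trans (hαA 0)
  induction i with
  | zero => linarith
  | succ i ih =>
    have h1 : |α i * g i| ≤ A := by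
      rw [abs_mul, abs_of_nonneg (hα i)]
      nlinarith [hα i, hαA i, hg i, abs_nonneg (g i)]
    have h0 := abs_nonneg (v 0 - θ)
    rw [abs_le] at h1 ih ⊢
    rw [hv]
    rcases lt_or_ge (θ + R) (v i) with h | h
    · have := mul_nonneg (hα i) (hup i h)
      constructor <;> linarith
    · rcases lt_or_ge (v i) (θ - R) with h' | h'
      · have := mul_nonneg (hα i) (neg_nonneg.2 (hdown i h'))
        constructor <;> linarith
      · constructor <;> linarith

/-! ### Step sizes -/

theorem stepSize_pos {c : ℝ} (hc : 0 < c) (τ : ℝ) (i : ℕ) : 0 < stepSize c τ i := by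
  unfold stepSize; positivity

theorem tendsto_stepSize (c : ℝ) {τ : ℝ} (hτ : 0 < τ) :
    Tendsto (stepSize c τ) atTop (𝓝 0) :=
  tendsto_const_nhds.div_atTop ((tendsto_rpow_atTop hτ).comp
    (tendsto_atTop_add_const_right _ _ tendsto_natCast_atTop_atTop))

theorem summable_stepSize_iff {c τ : ℝ} (hc : c ≠ 0) : Summable (stepSize c τ) ↔ 1 < τ := by
  have h : stepSize c τ = fun i : ℕ => c * (fun n : ℕ => 1 / (n : ℝ) ^ τ) (i + 1) := by
    funext i
    simp [stepSize, div_eq_mul_inv]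
  rw [h, summable_mul_left_iff hc, summable_nat_add_iff (f := fun n : ℕ => 1 / (n : ℝ) ^ τ) 1,
    Real.summable_one_div_nat_rpow]

theorem tendsto_sum_stepSize {c τ : ℝ} (hc : 0 < c) (hτ : τ ≤ 1) :
    Tendsto (fun n => ∑ i ∈ Finset.range n, stepSize c τ i) atTop atTop :=
  (not_summable_iff_tendsto_nat_atTop_of_nonneg fun i => (stepSize_pos hc τ i).le).1
    (by rw [summable_stepSize_iff hc.ne']; linarith)

theorem stepSize_sq (c τ : ℝ) (i : ℕ) : stepSize c τ i ^ 2 = stepSize (c ^ 2) (2 * τ) i := by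
  have : (0 : ℝ) ≤ (i : ℝ) + 1 := by positivity
  rw [stepSize, stepSize, div_pow, mul_comm 2 τ, Real.rpow_mul this, Real.rpow_two]

theorem summable_stepSize_sq {c τ : ℝ} (hc : 0 < c) (hτ : 1 / 2 < τ) :
    Summable fun i => stepSize c τ i ^ 2 := by
  simp_rw [stepSize_sq]
  exact (summable_stepSize_iff (by positivity)).2 (by linarith)

theorem stepSize_div (a b σ τ : ℝ) (i : ℕ) :
    stepSize a σ i / stepSize b τ i = stepSize (a / b) (σ - τ) i := by
  have : (0 : ℝ) < (i : ℝ) + 1 := by positivity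
  rw [stepSize, stepSize, stepSize, Real.rpow_sub this]
  field_simp

/-! ### The graph Laplacian on Euclidean space -/

section Laplacian

variable {N : ℕ}

/-- The Laplacian as a continuous linear operator on Euclidean space. -/
noncomputable def laplacian (G : SimpleGraph (Fin N)) [DecidableRel G.Adj] :
    EuclideanSpace ℝ (Fin N) →L[ℝ] EuclideanSpace ℝ (Fin N) :=
  Matrix.toEuclideanCLM (𝕜 := ℝ) (G.lapMatrix ℝ)

/-- The arithmetic mean of the coordinates. -/
noncomputable def mean : EuclideanSpace ℝ (Fin N) →ₗ[ℝ] ℝ where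
  toFun v := (1 / (N : ℝ)) * ∑ n, v n
  map_add' v w := by simp [Finset.sum_add_distrib, mul_add]
  map_smul' c v := by simp [← Finset.mul_sum]; ring

/-- The vector of deviations from the mean. -/
noncomputable def centered : EuclideanSpace ℝ (Fin N) →ₗ[ℝ] EuclideanSpace ℝ (Fin N) :=
  LinearMap.id - mean.smulRight (WithLp.toLp 2 fun _ => 1)

theorem mean_apply (v : EuclideanSpace ℝ (Fin N)) : mean v = (1 / (N : ℝ)) * ∑ n, v n := rfl

theorem centered_apply (v : EuclideanSpace ℝ (Fin N)) (n : Fin N) :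
    centered v n = v n - mean v := by
  simp [centered]

theorem centered_eq (v : EuclideanSpace ℝ (Fin N)) :
    centered v = v - mean v • WithLp.toLp 2 fun _ => 1 := by
  simp [centered]

theorem sum_centered [NeZero N] (v : EuclideanSpace ℝ (Fin N)) : ∑ n, centered v n = 0 := by
  have : (N : ℝ) ≠ 0 := NeZero.ne _
  simp only [centered_apply, Finset.sum_sub_distrib, mean_apply]
  simp
  field_simp
  ring

theorem abs_mean_le {v : EuclideanSpace ℝ (Fin N)} {B : ℝ} (hB : 0 ≤ B) (hv : ∀ n, |v n| ≤ B) :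
    |mean v| ≤ B := by
  rw [mean_apply, abs_mul, abs_of_nonneg (by positivity : (0 : ℝ) ≤ 1 / N)]
  have h : |∑ n, v n| ≤ N * B :=
    (Finset.abs_sum_le_sum_abs _ _).trans ((Finset.sum_le_sum fun n _ => hv n).trans (by simp))
  rcases Nat.eq_zero_or_pos N with rfl | hN
  · simpa using hB
  · have : (0 : ℝ) < N := by exact_mod_cast hN
    rw [one_div, inv_mul_le_iff₀ this]
    exact h

theorem norm_le_of_abs_le {v : EuclideanSpace ℝ (Fin N)} {B : ℝ}
    (hv : ∀ n, |v n| ≤ B) : ‖v‖ ≤ N * B := by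
  have h : ‖v‖ ≤ ∑ n, |v n| := by
    rw [EuclideanSpace.norm_eq]
    refine Real.sqrt_le_iff.2 ⟨by positivity, ?_⟩
    simp only [Real.norm_eq_abs]
    exact Finset.sum_sq_le_sq_sum_of_nonneg fun i _ => abs_nonneg _
  exact h.trans ((Finset.sum_le_sum fun n _ => hv n).trans (by simp))

theorem norm_centered_le {v : EuclideanSpace ℝ (Fin N)} (hv : ∀ n, |v n| ≤ 1) :
    ‖centered v‖ ≤ N * 2 := by
  refine norm_le_of_abs_le fun n => ?_
  rw [centered_apply]
  have h1 := abs_le.1 (hv n)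
  have h2 := abs_le.1 (abs_mean_le zero_le_one hv)
  rw [abs_le]
  constructor <;> linarith

variable (G : SimpleGraph (Fin N)) [DecidableRel G.Adj]

theorem laplacian_apply (v : EuclideanSpace ℝ (Fin N)) (n : Fin N) :
    laplacian G v n = (G.lapMatrix ℝ).mulVec v.ofLp n := by
  simp [laplacian]

theorem laplacian_const : laplacian G (WithLp.toLp 2 fun _ => 1) = 0 := by
  ext n
  rw [laplacian_apply]
  exact congrFun (G.lapMatrix_mulVec_const_eq_zero (R := ℝ)) n

theorem laplacian_centered (v : EuclideanSpace ℝ (Fin N)) :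
    laplacian G (centered v) = laplacian G v := by
  rw [centered_eq, map_sub, map_smul, laplacian_const, smul_zero, sub_zero]

/-- By symmetry, `L 1 = 0` also gives `1ᵀ L = 0`. -/
theorem mean_laplacian (v : EuclideanSpace ℝ (Fin N)) : mean (laplacian G v) = 0 := by
  have h : ∑ n, laplacian G v n = (fun _ => (1 : ℝ)) ⬝ᵥ (G.lapMatrix ℝ).mulVec v.ofLp := by
    simp [dotProduct, laplacian_apply]
  rw [mean_apply, h, Matrix.dotProduct_mulVec, ← Matrix.mulVec_transpose,
    (G.isSymm_lapMatrix (R := ℝ)).eq, G.lapMatrix_mulVec_const_eq_zero]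
  simp

theorem centered_laplacian (v : EuclideanSpace ℝ (Fin N)) :
    centered (laplacian G v) = laplacian G v := by
  rw [centered_eq, mean_laplacian, zero_smul, sub_zero]

theorem inner_laplacian (v : EuclideanSpace ℝ (Fin N)) :
    inner ℝ v (laplacian G v) = Matrix.toLinearMap₂' ℝ (G.lapMatrix ℝ) v.ofLp v.ofLp := by
  rw [Matrix.toLinearMap₂'_apply', PiLp.inner_apply, dotProduct]
  refine Finset.sum_congr rfl fun n _ => ?_
  rw [laplacian_apply]
  simp [mul_comm]

variable {G}

/-- The Laplacian of a connected graph is bounded below on vectors of mean zero. -/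
theorem exists_spectral_gap (hG : G.Connected) :
    ∃ c > 0, ∀ v : EuclideanSpace ℝ (Fin N), ∑ n, v n = 0 →
      c * ‖v‖ ^ 2 ≤ inner ℝ v (laplacian G v) := by
  -- By homogeneity unit vectors suffice. On this compact set, possibly empty, the form is positive:
  -- zero energy makes `v` constant on the connected graph, and mean zero then makes it vanish.
  have hK : IsCompact (Metric.sphere (0 : EuclideanSpace ℝ (Fin N)) 1 ∩ {v | ∑ n, v n = 0}) :=
    (isCompact_sphere _ _).inter_right (isClosed_eq (by fun_prop) continuous_const)
  obtain ⟨c, hc, h⟩ := hK.exists_forall_le' (f := fun v => inner ℝ v (laplacian G v)) (a := 0)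
    (by fun_prop) (by
      rintro v ⟨hv1, hv0⟩
      have h0 : 0 ≤ inner ℝ v (laplacian G v) := by
        rw [inner_laplacian, SimpleGraph.lapMatrix_toLinearMap₂']
        positivity
      refine h0.lt_of_ne fun hz => ?_
      rw [eq_comm, inner_laplacian,
        SimpleGraph.lapMatrix_toLinearMap₂'_apply'_eq_zero_iff_forall_reachable] at hz
      have hv : v = 0 := by
        ext n
        have hs : ∑ m, v m = N * v n := by
          rw [Finset.sum_congr rfl fun m _ => hz m n (hG.preconnected m n)]
          simp
        have hN : (N : ℝ) ≠ 0 := by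
          have : N ≠ 0 := by rintro rfl; exact n.elim0
          exact_mod_cast this
        rw [Set.mem_ofPred_eq, hs] at hv0
        simpa [hN] using hv0
      simp [hv] at hv1)
  refine ⟨c, hc, fun v hv => ?_⟩
  rcases eq_or_ne v 0 with rfl | hv0
  · simp
  · have hn : ‖v‖ ≠ 0 := norm_ne_zero_iff.2 hv0
    have := h (‖v‖⁻¹ • v) ⟨by simp [norm_smul, hn], by simp [← Finset.mul_sum, hv]⟩
    rw [map_smul, inner_smul_left, inner_smul_right] at this
    simp only [map_inv₀, conj_trivial] at this
    rw [← mul_assoc, ← mul_inv, ← sq, le_inv_mul_iff₀ (by positivity)] at this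
    linarith

/-- For small gains, averaging contracts vectors of mean zero. -/
theorem exists_contraction (hG : G.Connected) :
    ∃ c > 0, ∃ h > 0, ∀ b, 0 ≤ b → b ≤ h → c * b ≤ 1 ∧
      ∀ v : EuclideanSpace ℝ (Fin N), ∑ n, v n = 0 →
        ‖v - b • laplacian G v‖ ≤ (1 - c * b) * ‖v‖ := by
  obtain ⟨c, hc, h⟩ := exists_spectral_gap hG
  set Λ := ‖laplacian G‖
  have hΛ : 0 ≤ Λ := norm_nonneg _
  -- The squared norm is at most `(1 - 2bc + b²Λ²) ‖v‖² ≤ (1 - bc) ‖v‖² ≤ (1 - bc/2)² ‖v‖²`. The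
  -- first cap on `b` gives `bΛ² ≤ c`, the second `bc ≤ 1`.
  refine ⟨c / 2, by positivity, min (c / (Λ ^ 2 + 1)) (1 / c), by positivity, fun b hb hbh => ?_⟩
  have h1 : b * (Λ ^ 2 + 1) ≤ c := (le_div_iff₀ (by positivity)).1 (hbh.trans (min_le_left _ _))
  have h2 : b * c ≤ 1 := (le_div_iff₀ hc).1 (hbh.trans (min_le_right _ _))
  refine ⟨by linarith, fun v hv => ?_⟩
  refine abs_le_of_sq_le_sq' ?_ (mul_nonneg (by linarith) (norm_nonneg v)) |>.2
  rw [norm_sub_sq_real, inner_smul_right, norm_smul, Real.norm_of_nonneg hb]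
  have h3 : ‖laplacian G v‖ ^ 2 ≤ Λ ^ 2 * ‖v‖ ^ 2 := by
    rw [← mul_pow]
    exact pow_le_pow_left₀ (norm_nonneg _) ((laplacian G).le_opNorm v) 2
  have h4 := mul_le_mul_of_nonneg_left (h v hv) hb
  have h5 := mul_le_mul_of_nonneg_left h3 (mul_nonneg hb hb)
  have h6 : b * (b * Λ ^ 2) * ‖v‖ ^ 2 ≤ b * c * ‖v‖ ^ 2 := by
    gcongr
    linarith
  nlinarith [sq_nonneg (c * b * ‖v‖)]

end Laplacian

/-! ### The disagreement between the nodes -/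

section Recursion

variable {N : ℕ} {G : SimpleGraph (Fin N)} [DecidableRel G.Adj]
  {α η : ℕ → ℝ} {u y T : ℕ → EuclideanSpace ℝ (Fin N)}

theorem mean_succ {a b : ℝ} {u y T : EuclideanSpace ℝ (Fin N)} :
    mean ((u - a • y) - b • laplacian G (u - a • y) + b • laplacian G T)
      = mean u - a * mean y := by
  rw [map_add, map_sub, map_smul, map_smul, mean_laplacian, mean_laplacian, map_sub, map_smul]
  simp

theorem centered_succ {a b : ℝ} {u y T : EuclideanSpace ℝ (Fin N)} :
    centered ((u - a • y) - b • laplacian G (u - a • y) + b • laplacian G T)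
      = centered (u - a • y) - b • laplacian G (centered (u - a • y)) + b • laplacian G T := by
  rw [map_add, map_sub, map_smul, map_smul, centered_laplacian, centered_laplacian,
    laplacian_centered]

/-- The factor `κ` is left free: `1 - c * b` once the gain is small, `1 + b * ‖L‖` at early times.
-/
theorem norm_centered_succ_le {a b : ℝ} {u y T : EuclideanSpace ℝ (Fin N)} {κ : ℝ}
    (ha : 0 ≤ a) (hb : 0 ≤ b) (hy : ∀ n, |y n| ≤ 1) (hκ0 : 0 ≤ κ)
    (hκ : ‖centered (u - a • y) - b • laplacian G (centered (u - a • y))‖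
      ≤ κ * ‖centered (u - a • y)‖) :
    ‖centered ((u - a • y) - b • laplacian G (u - a • y) + b • laplacian G T)‖
      ≤ κ * (‖centered u‖ + a * (N * 2)) + b * (‖laplacian G‖ * ‖T‖) := by
  rw [centered_succ]
  refine (norm_add_le _ _).trans (add_le_add (hκ.trans ?_) ?_)
  · refine mul_le_mul_of_nonneg_left ?_ hκ0
    rw [map_sub, map_smul]
    refine (norm_sub_le _ _).trans (add_le_add_right ?_ _)
    rw [norm_smul, Real.norm_of_nonneg ha]
    exact mul_le_mul_of_nonneg_left (norm_centered_le hy) ha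
  · rw [norm_smul, Real.norm_of_nonneg hb]
    exact mul_le_mul_of_nonneg_left ((laplacian G).le_opNorm T) hb

theorem exists_norm_centered_contracting (hG : G.Connected) (hα : ∀ i, 0 ≤ α i)
    (hη : ∀ i, 0 < η i) (hη0 : Tendsto η atTop (𝓝 0)) :
    ∃ c > 0, ∃ i₀, (∀ i, i₀ ≤ i → c * η i ≤ 1) ∧
      ∀ u y T : ℕ → EuclideanSpace ℝ (Fin N), (∀ i n, |y i n| ≤ 1) →
      (∀ i, u (i + 1) = (u i - α i • y i) - η i • laplacian G (u i - α i • y i)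
        + η i • laplacian G (T i)) →
      ∀ i, i₀ ≤ i → ‖centered (u (i + 1))‖ ≤ (1 - c * η i) * ‖centered (u i)‖
        + η i * (α i / η i * (N * 2) + ‖laplacian G‖ * ‖T i‖) := by
  have : NeZero N := ⟨by rintro rfl; exact hG.nonempty.some.elim0⟩
  obtain ⟨c, hc, h, hh, H⟩ := exists_contraction hG
  obtain ⟨i₀, h0⟩ := eventually_atTop.1 (hη0.eventually_le_const hh)
  refine ⟨c, hc, i₀, fun i hi => (H _ (hη i).le (h0 i hi)).1, fun u y T hy hu i hi => ?_⟩
  obtain ⟨h1, h2⟩ := H _ (hη i).le (h0 i hi)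
  rw [hu]
  refine (norm_centered_succ_le (hα i) (hη i).le (hy i) (sub_nonneg.2 h1)
    (h2 _ (sum_centered _))).trans ?_
  have h3 : η i * (α i / η i * (N * 2)) = α i * (N * 2) := by
    have := (hη i).ne'
    field_simp
  have h4 : 0 ≤ α i * (N * 2 : ℝ) := mul_nonneg (hα i) (by positivity)
  nlinarith [mul_nonneg (mul_nonneg hc.le (hη i).le) h4]

theorem tendsto_norm_centered (hG : G.Connected) (hα : ∀ i, 0 ≤ α i) (hη : ∀ i, 0 < η i)
    (hη0 : Tendsto η atTop (𝓝 0)) (hαη : Tendsto (fun i => α i / η i) atTop (𝓝 0))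
    (hsum : Tendsto (fun n => ∑ i ∈ Finset.range n, η i) atTop atTop)
    (hy : ∀ i n, |y i n| ≤ 1)
    (hu : ∀ i, u (i + 1) = (u i - α i • y i) - η i • laplacian G (u i - α i • y i)
        + η i • laplacian G (T i))
    (hT : Tendsto T atTop (𝓝 0)) : Tendsto (fun i => ‖centered (u i)‖) atTop (𝓝 0) := by
  obtain ⟨c, hc, i₀, h1, h2⟩ := exists_norm_centered_contracting hG hα hη hη0
  refine tendsto_zero_of_contracting hc (fun i => (hη i).le) (eventually_atTop.2 ⟨i₀, h1⟩) hsum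
    (fun i => norm_nonneg _) (eventually_atTop.2 ⟨i₀, h2 u y T hy hu⟩) ?_
  simpa using (hαη.mul_const _).add (hT.norm.const_mul _)

/-- `K` is chosen before the path, so one constant serves all noise realizations. Averaging need not
contract before `i₀`, but those finitely many steps only enlarge `K`; afterwards
`le_max_of_contracting` applies. -/
theorem exists_norm_centered_le (hG : G.Connected) (hα : ∀ i, 0 ≤ α i) (hη : ∀ i, 0 < η i)
    (hη0 : Tendsto η atTop (𝓝 0)) (hαη : Tendsto (fun i => α i / η i) atTop (𝓝 0))
    (u₀ : EuclideanSpace ℝ (Fin N)) :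
    ∃ K, 0 ≤ K ∧ ∀ (u y T : ℕ → EuclideanSpace ℝ (Fin N)) (B : ℝ), 0 ≤ B → u 0 = u₀ →
      (∀ i n, |y i n| ≤ 1) →
      (∀ i, u (i + 1) = (u i - α i • y i) - η i • laplacian G (u i - α i • y i)
        + η i • laplacian G (T i)) →
      (∀ i, ‖T i‖ ≤ B) → ∀ i, ‖centered (u i)‖ ≤ K * (1 + B) := by
  obtain ⟨c, hc, i₀, h1, h2⟩ := exists_norm_centered_contracting hG hα hη hη0
  set Λ := ‖laplacian G‖
  have hΛ : 0 ≤ Λ := norm_nonneg _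
  obtain ⟨D, hD⟩ := hαη.bddAbove_range
  have hD : ∀ i, α i / η i ≤ D := fun i => hD ⟨i, rfl⟩
  have hD0 : 0 ≤ D := (div_nonneg (hα 0) (hη 0).le).trans (hD 0)
  have early : ∀ j, ∃ K, 0 ≤ K ∧ ∀ (u y T : ℕ → EuclideanSpace ℝ (Fin N)) (B : ℝ), 0 ≤ B →
      u 0 = u₀ → (∀ i n, |y i n| ≤ 1) →
      (∀ i, u (i + 1) = (u i - α i • y i) - η i • laplacian G (u i - α i • y i)
        + η i • laplacian G (T i)) →
      (∀ i, ‖T i‖ ≤ B) → ∀ i ≤ j, ‖centered (u i)‖ ≤ K * (1 + B) := by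
    intro j
    induction j with
    | zero =>
      refine ⟨‖centered u₀‖, norm_nonneg _, fun u y T B hB hu0 _ _ _ i hi => ?_⟩
      rw [Nat.le_zero.1 hi, hu0]
      nlinarith [norm_nonneg (centered u₀)]
    | succ j ih =>
      obtain ⟨K, hK, ih⟩ := ih
      have hαj := hα j
      have hηj := (hη j).le
      refine ⟨K + ((1 + η j * Λ) * (K + α j * (N * 2)) + η j * Λ), by positivity,
        fun u y T B hB hu0 hy hu hT i hi => ?_⟩
      have hr : 0 ≤ (1 + η j * Λ) * (K + α j * (N * 2)) + η j * Λ := by positivity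
      rcases Nat.le_or_eq_of_le_succ hi with hi | rfl
      · have := ih u y T B hB hu0 hy hu hT i hi
        nlinarith [mul_nonneg hr (by linarith : 0 ≤ 1 + B)]
      · have h3 := ih u y T B hB hu0 hy hu hT j le_rfl
        rw [hu]
        refine (norm_centered_succ_le hαj hηj (hy j) (κ := 1 + η j * Λ) (by positivity) ?_).trans ?_
        · refine (norm_sub_le _ _).trans ?_
          rw [norm_smul, Real.norm_of_nonneg hηj, add_mul, one_mul, mul_assoc]
          gcongr
          exact (laplacian G).le_opNorm _
        · have h4 : ‖centered (u j)‖ + α j * (N * 2) ≤ (K + α j * (N * 2)) * (1 + B) := by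
            have : 0 ≤ α j * (N * 2) * B := by positivity
            linarith
          have h5 : ‖T j‖ ≤ 1 + B := by linarith [hT j]
          calc (1 + η j * Λ) * (‖centered (u j)‖ + α j * (N * 2)) + η j * (Λ * ‖T j‖)
              ≤ (1 + η j * Λ) * ((K + α j * (N * 2)) * (1 + B)) + η j * (Λ * (1 + B)) := by gcongr
            _ ≤ _ := by
              have : 0 ≤ K * (1 + B) := by positivity
              linarith
  obtain ⟨K, hK, early⟩ := early i₀
  have hE : 0 ≤ (D * (N * 2) + Λ) / c := by positivity
  refine ⟨K + (D * (N * 2) + Λ) / c, by positivity, fun u y T B hB hu0 hy hu hT i => ?_⟩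
  have hK' := early u y T B hB hu0 hy hu hT
  have h1B : 0 ≤ 1 + B := by linarith
  rcases le_total i i₀ with hi | hi
  · nlinarith [hK' i hi, mul_nonneg hE h1B]
  · have hb : ∀ i, i₀ ≤ i → α i / η i * (N * 2) + Λ * ‖T i‖ ≤ (D * (N * 2) + Λ) * (1 + B) := by
      intro i _
      have e1 : α i / η i * (N * 2) ≤ D * (N * 2) := by
        gcongr
        exact hD i
      have e2 : Λ * ‖T i‖ ≤ Λ * B := mul_le_mul_of_nonneg_left (hT i) hΛ
      have e3 : 0 ≤ D * (N * 2) * B := by positivity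
      linarith
    have h5 := le_max_of_contracting (a := fun i => ‖centered (u i)‖) hc (fun i => (hη i).le) h1
      (h2 u y T hy hu) hb i hi
    refine h5.trans (max_le ?_ ?_)
    · nlinarith [hK' i₀ le_rfl, mul_nonneg hE h1B]
    · rw [mul_div_right_comm]
      nlinarith [mul_nonneg hK h1B]

end Recursion

/-! ### The empirical quantile -/

section Quantile

variable {N : ℕ} {x : Fin N → ℝ} {p : ℝ}

theorem step_mono : Monotone step := by
  intro s t h
  unfold step
  split_ifs <;> linarith

theorem step_nonneg (t : ℝ) : 0 ≤ step t := by
  unfold step; split_ifs <;> norm_num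

theorem step_le_one (t : ℝ) : step t ≤ 1 := by
  unfold step; split_ifs <;> norm_num

theorem ecdf_mono : Monotone (ecdf x) := fun s t h =>
  mul_le_mul_of_nonneg_left
    (Finset.sum_le_sum fun n _ => step_mono (sub_le_sub_right h _)) (by positivity)

theorem ecdf_eq_div (w : ℝ) : ∃ k ≤ N, ecdf x w = (k : ℝ) / N := by
  refine ⟨(Finset.univ.filter fun n => 0 ≤ w - x n).card,
    (Finset.card_le_univ _).trans (by simp), ?_⟩
  unfold ecdf step
  rw [Finset.sum_boole]
  ring

theorem ecdf_eq_zero {w : ℝ} (hw : ∀ n, w < x n) : ecdf x w = 0 := by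
  unfold ecdf step
  rw [Finset.sum_eq_zero fun n _ => if_neg (by linarith [hw n]), mul_zero]

theorem ecdf_eq_one [NeZero N] {w : ℝ} (hw : ∀ n, x n ≤ w) : ecdf x w = 1 := by
  have : (N : ℝ) ≠ 0 := NeZero.ne _
  unfold ecdf step
  rw [Finset.sum_congr rfl fun n _ => if_pos (by linarith [hw n])]
  simp [this]

theorem le_ecdf_of_quantile_lt [NeZero N] (hp1 : p < 1) {w : ℝ} (hw : quantile x p < w) :
    p ≤ ecdf x w := by
  have hne : {w : ℝ | p ≤ ecdf x w}.Nonempty := by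
    obtain ⟨M, hM⟩ := (Set.finite_range x).bddAbove
    exact ⟨M, by rw [Set.mem_ofPred_eq, ecdf_eq_one fun n => hM ⟨n, rfl⟩]; exact hp1.le⟩
  obtain ⟨v, hv, hvw⟩ := exists_lt_of_csInf_lt hne hw
  exact le_trans hv (ecdf_mono hvw.le)

theorem ecdf_lt_of_lt_quantile (hp0 : 0 < p) {w : ℝ} (hw : w < quantile x p) :
    ecdf x w < p := by
  by_contra! h
  obtain ⟨m, hm⟩ := (Set.finite_range x).bddBelow
  have hb : BddBelow {w : ℝ | p ≤ ecdf x w} := by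
    refine ⟨m, fun v hv => ?_⟩
    by_contra! hvm
    rw [Set.mem_ofPred_eq, ecdf_eq_zero fun n => hvm.trans_le (hm ⟨n, rfl⟩)] at hv
    linarith
  exact (csInf_le hb h).not_gt hw

/-- Off the quantile the empirical distribution function is uniformly bounded away from `p`. -/
theorem exists_ecdf_gap [NeZero N] (x : Fin N → ℝ) (hp0 : 0 < p) (hp1 : p < 1)
    (hp : ∀ k ∈ Finset.Icc 1 N, p ≠ (k : ℝ) / (N : ℝ)) :
    ∃ c > 0, ∀ w, (quantile x p < w → c ≤ ecdf x w - p) ∧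
      (w < quantile x p → ecdf x w - p ≤ -c) := by
  -- The gap is the distance from `p` to the values `k / N`, `0 ≤ k ≤ N`; the value `k = 0` is
  -- excluded by `0 < p`.
  obtain ⟨k₀, hk₀, hmin⟩ := (Finset.range (N + 1)).exists_min_image
    (fun k : ℕ => |(k : ℝ) / N - p|) ⟨0, by simp⟩
  refine ⟨|(k₀ : ℝ) / N - p|, abs_pos.2 (sub_ne_zero.2 ?_), fun w => ?_⟩
  · rcases Nat.eq_zero_or_pos k₀ with rfl | hk
    · simpa using hp0.ne
    · exact (hp k₀ (by simp at hk₀ ⊢; lia)).symm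
  · obtain ⟨k, hk, hkw⟩ := ecdf_eq_div (x := x) w
    have h := hmin k (by simp; lia)
    rw [hkw]
    constructor <;> intro hw
    · have h1 := le_ecdf_of_quantile_lt hp1 hw
      rwa [abs_of_nonneg (by linarith : 0 ≤ (k : ℝ) / N - p)] at h
    · have h1 := ecdf_lt_of_lt_quantile hp0 hw
      rw [abs_of_neg (by linarith : (k : ℝ) / N - p < 0)] at h
      linarith

end Quantile

/-! ### Pathwise behaviour of the states -/

section Pathwise

variable {N : ℕ} {G : SimpleGraph (Fin N)} [DecidableRel G.Adj] {x : Fin N → ℝ} {p : ℝ}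

/-- The subgradient errors `u(w_n - x_n) - p`. -/
noncomputable def gradient (x : Fin N → ℝ) (p : ℝ) (w : Fin N → ℝ) :
    EuclideanSpace ℝ (Fin N) :=
  WithLp.toLp 2 fun n => step (w n - x n) - p

theorem abs_gradient_le (hp0 : 0 < p) (hp1 : p < 1) (w : Fin N → ℝ) (n : Fin N) :
    |gradient x p w n| ≤ 1 := by
  have h1 := step_nonneg (w n - x n)
  have h2 := step_le_one (w n - x n)
  rw [gradient, abs_le]
  constructor <;> simp only <;> linarith

theorem mean_gradient [NeZero N] (w : Fin N → ℝ) :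
    mean (gradient x p w) = 1 / N * ∑ n, step (w n - x n) - p := by
  have hN : (N : ℝ) ≠ 0 := NeZero.ne _
  simp only [mean_apply, gradient, Finset.sum_sub_distrib]
  simp
  field_simp

/-- Monotonicity of `step` replaces the differing node states by a common level. -/
theorem mean_gradient_ge [NeZero N] {w : Fin N → ℝ} {v : ℝ} (h : ∀ n, v ≤ w n) :
    ecdf x v - p ≤ mean (gradient x p w) := by
  rw [mean_gradient, ecdf]
  gcongr with n
  exact step_mono (sub_le_sub_right (h n) _)

theorem mean_gradient_le [NeZero N] {w : Fin N → ℝ} {v : ℝ} (h : ∀ n, w n ≤ v) :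
    mean (gradient x p w) ≤ ecdf x v - p := by
  rw [mean_gradient, ecdf]
  gcongr with n
  exact step_mono (sub_le_sub_right (h n) _)

/-- The accumulated noise at each node. -/
noncomputable def noiseSum (G : SimpleGraph (Fin N)) [DecidableRel G.Adj] (η : ℕ → ℝ)
    (z : Fin N → Fin N → ℕ → ℝ) (i : ℕ) : EuclideanSpace ℝ (Fin N) :=
  WithLp.toLp 2 fun n => -∑ l ∈ G.neighborFinset n, ∑ j ∈ Finset.range i, η j * z n l j

variable {α η : ℕ → ℝ} {z : Fin N → Fin N → ℕ → ℝ} {S : EuclideanSpace ℝ (Fin N)}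

/-- The state with the accumulated noise removed, up to the constant vector `S`. -/
noncomputable def denoised (G : SimpleGraph (Fin N)) [DecidableRel G.Adj] (x : Fin N → ℝ) (p : ℝ)
    (α η : ℕ → ℝ) (z : Fin N → Fin N → ℕ → ℝ) (S : EuclideanSpace ℝ (Fin N)) (i : ℕ) :
    EuclideanSpace ℝ (Fin N) :=
  WithLp.toLp 2 (state G x p α η z i) + (noiseSum G η z i - S)

/-- The fresh noise cancels against the increment of `noiseSum`; rewriting `L` of the state through
`denoised` leaves the last term. -/
theorem denoised_succ (i : ℕ) :
    denoised G x p α η z S (i + 1) =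
      (denoised G x p α η z S i - α i • gradient x p (state G x p α η z i))
      - η i • laplacian G (denoised G x p α η z S i - α i • gradient x p (state G x p α η z i))
      + η i • laplacian G (noiseSum G η z i - S) := by
  have h1 : WithLp.toLp 2 (state G x p α η z (i + 1)) =
      (WithLp.toLp 2 (state G x p α η z i) - α i • gradient x p (state G x p α η z i))
      - η i • laplacian G (WithLp.toLp 2 (state G x p α η z i)
          - α i • gradient x p (state G x p α η z i))
      - η i • WithLp.toLp 2 (fun n => -∑ l ∈ G.neighborFinset n, z n l i) := by
    rw [state_succ, Matrix.sub_mulVec, Matrix.one_mulVec, Matrix.smul_mulVec]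
    ext n
    simp only [PiLp.sub_apply, PiLp.smul_apply, laplacian_apply]
    rfl
  have h2 : noiseSum G η z (i + 1) = noiseSum G η z i
      + η i • WithLp.toLp 2 (fun n => -∑ l ∈ G.neighborFinset n, z n l i) := by
    ext n
    simp [noiseSum, Finset.sum_range_succ, Finset.sum_add_distrib, Finset.mul_sum]
    ring
  rw [denoised, h1, h2, denoised]
  simp only [map_sub, map_add]
  module

theorem abs_state_sub_mean_le (i : ℕ) (n : Fin N) :
    |state G x p α η z i n - mean (denoised G x p α η z S i)|
      ≤ ‖centered (denoised G x p α η z S i)‖ + ‖noiseSum G η z i - S‖ := by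
  have h1 := PiLp.norm_apply_le (centered (denoised G x p α η z S i)) n
  have h2 := PiLp.norm_apply_le (noiseSum G η z i - S) n
  rw [Real.norm_eq_abs] at h1 h2
  have e : state G x p α η z i n - mean (denoised G x p α η z S i)
      = centered (denoised G x p α η z S i) n - (noiseSum G η z i - S) n := by
    rw [centered_apply]
    have : denoised G x p α η z S i n = state G x p α η z i n + (noiseSum G η z i - S) n := rfl
    rw [this]
    ring
  rw [e]
  exact (abs_sub _ _).trans (add_le_add h1 h2)

theorem mean_denoised_succ (i : ℕ) :
    mean (denoised G x p α η z S (i + 1)) = mean (denoised G x p α η z S i)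
      - α i * mean (gradient x p (state G x p α η z i)) := by
  rw [denoised_succ, mean_succ]

/-- Along a noise realization whose accumulated noise converges, every state converges to the
quantile. -/
theorem tendsto_state (hG : G.Connected) (hp0 : 0 < p) (hp1 : p < 1)
    (hp : ∀ k ∈ Finset.Icc 1 N, p ≠ (k : ℝ) / (N : ℝ))
    (hα : ∀ i, 0 ≤ α i) (hη : ∀ i, 0 < η i) (hα0 : Tendsto α atTop (𝓝 0))
    (hη0 : Tendsto η atTop (𝓝 0)) (hαη : Tendsto (fun i => α i / η i) atTop (𝓝 0))
    (hαsum : Tendsto (fun n => ∑ i ∈ Finset.range n, α i) atTop atTop)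
    (hηsum : Tendsto (fun n => ∑ i ∈ Finset.range n, η i) atTop atTop)
    (hz : ∀ n l, G.Adj n l →
      ∃ s, Tendsto (fun k => ∑ j ∈ Finset.range k, η j * z n l j) atTop (𝓝 s)) (n : Fin N) :
    Tendsto (fun i => state G x p α η z i n) atTop (𝓝 (quantile x p)) := by
  have : NeZero N := ⟨by rintro rfl; exact n.elim0⟩
  have hz' : ∀ n l, ∃ s, G.Adj n l →
      Tendsto (fun k => ∑ j ∈ Finset.range k, η j * z n l j) atTop (𝓝 s) := by
    intro n l
    by_cases h : G.Adj n l
    · obtain ⟨s, hs⟩ := hz n l h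
      exact ⟨s, fun _ => hs⟩
    · exact ⟨0, fun h' => absurd h' h⟩
  choose s hs using hz'
  set S : EuclideanSpace ℝ (Fin N) := WithLp.toLp 2 fun n => -∑ l ∈ G.neighborFinset n, s n l
  have hT : Tendsto (fun i => noiseSum G η z i - S) atTop (𝓝 0) := by
    rw [← sub_self S]
    refine Tendsto.sub_const ((PiLp.continuous_toLp 2 _).continuousAt.tendsto.comp
      (tendsto_pi_nhds.2 fun n => (tendsto_finsetSum _ fun l hl => hs n l ?_).neg)) S
    simpa using hl
  have hc := tendsto_norm_centered (u := denoised G x p α η z S)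
    (y := fun i => gradient x p (state G x p α η z i)) hG hα hη hη0 hαη hηsum
    (fun i => abs_gradient_le hp0 hp1 _) denoised_succ hT
  have hr : Tendsto (fun i => ‖centered (denoised G x p α η z S i)‖ + ‖noiseSum G η z i - S‖)
      atTop (𝓝 0) := by simpa using hc.add hT.norm
  obtain ⟨c, hc0, hgap⟩ := exists_ecdf_gap x hp0 hp1 hp
  have hm : Tendsto (fun i => mean (denoised G x p α η z S i)) atTop (𝓝 (quantile x p)) := by
    refine tendsto_of_drift hc0 hα hα0 hαsum mean_denoised_succ
      (fun i => abs_mean_le zero_le_one (abs_gradient_le hp0 hp1 _)) ?_ ?_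
    · intro ε hε
      -- With all nodes within `ε / 2` of a mean above `θ + ε`, every node exceeds `θ + ε / 2`,
      -- where the gap applies.
      filter_upwards [hr.eventually_lt_const (half_pos hε)] with i hi hv
      refine ((hgap (quantile x p + ε / 2)).1 (by linarith)).trans (mean_gradient_ge fun n => ?_)
      have := (abs_le.1 ((abs_state_sub_mean_le (S := S) i n).trans hi.le)).1
      linarith
    · intro ε hε
      filter_upwards [hr.eventually_lt_const (half_pos hε)] with i hi hv
      refine (mean_gradient_le fun n => ?_).trans ((hgap (quantile x p - ε / 2)).2 (by linarith))
      have := (abs_le.1 ((abs_state_sub_mean_le (S := S) i n).trans hi.le)).2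
      linarith
  have hd : Tendsto (fun i => state G x p α η z i n - mean (denoised G x p α η z S i)) atTop
      (𝓝 0) :=
    squeeze_zero_norm (fun i => abs_state_sub_mean_le i n) hr
  simpa using hd.add hm

/-- The states are bounded linearly in terms of the accumulated noise. -/
theorem exists_abs_state_le (hG : G.Connected) (x : Fin N → ℝ) (hp0 : 0 < p) (hp1 : p < 1)
    (hα : ∀ i, 0 ≤ α i) (hη : ∀ i, 0 < η i) (hα0 : Tendsto α atTop (𝓝 0))
    (hη0 : Tendsto η atTop (𝓝 0)) (hαη : Tendsto (fun i => α i / η i) atTop (𝓝 0)) :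
    ∃ K, ∀ (z : Fin N → Fin N → ℕ → ℝ) (B : ℝ), 0 ≤ B →
      (∀ n l, G.Adj n l → ∀ k, |∑ j ∈ Finset.range k, η j * z n l j| ≤ B) →
      ∀ i n, |state G x p α η z i n| ≤ K * (1 + B) := by
  have : NeZero N := ⟨by rintro rfl; exact hG.nonempty.some.elim0⟩
  obtain ⟨K, hK, hcen⟩ := exists_norm_centered_le hG hα hη hη0 hαη (WithLp.toLp 2 x)
  obtain ⟨A, hA⟩ := hα0.bddAbove_range
  have hA : ∀ i, α i ≤ A := fun i => hA ⟨i, rfl⟩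
  have hA0 : 0 ≤ A := (hα 0).trans (hA 0)
  set θ := quantile x p
  set m₀ := |mean (WithLp.toLp 2 x) - θ| + |θ| + A
  have hm₀ : 0 ≤ m₀ := by positivity
  -- With `R` below, one `R` is the distance of a node from the mean, the other the radius outside
  -- which the mean drifts towards `θ`.
  refine ⟨m₀ + 2 * (K * (1 + N * N) + N * N), fun z B hB hz => ?_⟩
  have hT : ∀ i, ‖noiseSum G η z i‖ ≤ N * (N * B) := by
    refine fun i => norm_le_of_abs_le fun n => ?_
    simp only [noiseSum, abs_neg]
    refine (Finset.abs_sum_le_sum_abs _ _).trans ((Finset.sum_le_sum fun l hl =>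
      hz n l (by simpa using hl) i).trans ?_)
    rw [Finset.sum_const, nsmul_eq_mul]
    gcongr
    exact (Finset.card_le_univ _).trans (by simp)
  -- Here `S = 0`: only boundedness of the noise sums is available, and the initial vector is
  -- deterministic.
  have h0 : denoised G x p α η z 0 0 = WithLp.toLp 2 x := by
    ext n
    simp [denoised, noiseSum, state]
  have hc := hcen (denoised G x p α η z 0) (fun i => gradient x p (state G x p α η z i))
    (fun i => noiseSum G η z i - 0) (N * (N * B)) (by positivity) h0
    (fun i => abs_gradient_le hp0 hp1 _) denoised_succ (by simpa using hT)
  set R := K * (1 + N * (N * B)) + N * (N * B)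
  have hR : 0 ≤ R := by positivity
  have hdev : ∀ i n, |state G x p α η z i n - mean (denoised G x p α η z 0 i)| ≤ R := fun i n =>
    (abs_state_sub_mean_le i n).trans (add_le_add (hc i) (by simpa using hT i))
  have hm := abs_sub_le_of_drift (v := fun i => mean (denoised G x p α η z 0 i)) (θ := θ)
    hα hA hR mean_denoised_succ
    (fun i => abs_mean_le zero_le_one (abs_gradient_le hp0 hp1 _)) (fun i hi => by
      refine le_trans (sub_nonneg.2 (le_ecdf_of_quantile_lt hp1 (w :=
        mean (denoised G x p α η z 0 i) - R) (by linarith))) (mean_gradient_ge fun n => ?_)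
      linarith [(abs_le.1 (hdev i n)).1]) (fun i hi => by
      refine (mean_gradient_le (v := mean (denoised G x p α η z 0 i) + R) fun n => ?_).trans
        (sub_nonpos.2 (ecdf_lt_of_lt_quantile hp0 (by linarith)).le)
      linarith [(abs_le.1 (hdev i n)).2])
  intro i n
  have h1 := hdev i n
  have h2 := hm i
  rw [h0] at h2
  have h3 : |state G x p α η z i n| ≤ m₀ + 2 * R := by
    have h4 := neg_abs_le θ
    have h5 := le_abs_self θ
    rw [abs_le] at h1 h2 ⊢
    constructor <;> linarith
  refine h3.trans ?_
  have h6 : 0 ≤ m₀ * B + 2 * K * (B + N * N) + 2 * (N * N) := by positivity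
  linarith

end Pathwise

/-! ### Weighted sums of independent centred variables -/

section Martingale

open scoped ENNReal NNReal

variable {Ω : Type*} [MeasurableSpace Ω] {P : Measure Ω} [IsProbabilityMeasure P]
  {X : ℕ → Ω → ℝ} {a : ℕ → ℝ}

/-- Partial sums of independent centred variables with deterministic weights form a martingale with
respect to the shifted natural filtration. -/
theorem martingale_weighted_sum (hX : ∀ i, StronglyMeasurable (X i)) (hind : iIndepFun X P)
    (hint : ∀ i, Integrable (X i) P) (hmean : ∀ i, ∫ w, X i w ∂P = 0) (a : ℕ → ℝ) :
    Martingale (fun k w => ∑ j ∈ Finset.range (k + 1), a j * X j w)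
      (Filtration.natural X hX) P := by
  refine martingale_nat ?_ (fun k => integrable_finsetSum _ fun j _ => (hint j).const_mul _) ?_
  · intro k
    refine Finset.stronglyMeasurable_fun_sum _ fun j hj => StronglyMeasurable.const_mul ?_ _
    exact (Filtration.stronglyAdapted_natural hX j).mono
      ((Filtration.natural X hX).mono (by simp at hj; lia))
  · intro k
    set F := Filtration.natural X hX
    have hS : StronglyMeasurable[F k] fun w => ∑ j ∈ Finset.range (k + 1), a j * X j w := by
      refine Finset.stronglyMeasurable_fun_sum _ fun j hj => StronglyMeasurable.const_mul ?_ _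
      exact (Filtration.stronglyAdapted_natural hX j).mono (F.mono (by simp at hj; lia))
    have hSi : Integrable (fun w => ∑ j ∈ Finset.range (k + 1), a j * X j w) P :=
      integrable_finsetSum _ fun j _ => (hint j).const_mul _
    have e : (fun w => ∑ j ∈ Finset.range (k + 1 + 1), a j * X j w)
        = (fun w => ∑ j ∈ Finset.range (k + 1), a j * X j w) + a (k + 1) • X (k + 1) := by
      funext w
      simp [Finset.sum_range_succ _ (k + 1)]
    rw [e]
    have h1 := condExp_add hSi ((hint (k + 1)).smul (a (k + 1))) (F k)
    have h2 := condExp_smul (μ := P) (a (k + 1)) (X (k + 1)) (F k)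
    -- The sum at time `k` ends with `X k`, so the next increment is independent of `F k`.
    have h3 := hind.condExp_natural_ae_eq_of_lt hX (Nat.lt_succ_self k)
    filter_upwards [h1, h2, h3] with w h1 h2 h3
    rw [h1, Pi.add_apply, h2, Pi.smul_apply, h3, hmean,
      condExp_of_stronglyMeasurable (F.le k) hS hSi]
    simp

theorem integral_weighted_sum_sq (hL2 : ∀ i, MemLp (X i) 2 P) (hind : iIndepFun X P)
    (hmean : ∀ i, ∫ w, X i w ∂P = 0) (a : ℕ → ℝ) (k : ℕ) :
    ∫ w, (∑ j ∈ Finset.range k, a j * X j w) ^ 2 ∂P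
      = ∑ j ∈ Finset.range k, a j ^ 2 * ∫ w, X j w ^ 2 ∂P := by
  have hY : ∀ j, MemLp (fun w => a j * X j w) 2 P := fun j => (hL2 j).const_mul _
  have hY0 : ∀ j, ∫ w, a j * X j w ∂P = 0 := fun j => by
    rw [integral_const_mul, hmean, mul_zero]
  have h := IndepFun.variance_sum (μ := P) (X := fun j w => a j * X j w) (s := Finset.range k)
    (fun j _ => hY j) (fun i _ j _ hij => (hind.indepFun hij).comp
      (measurable_const_mul (a i)) (measurable_const_mul (a j)))
  have hs : MemLp (∑ j ∈ Finset.range k, fun w => a j * X j w) 2 P :=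
    memLp_finsetSum' _ fun j _ => hY j
  have hs0 : ∫ w, (∑ j ∈ Finset.range k, fun w => a j * X j w) w ∂P = 0 := by
    simp only [Finset.sum_apply]
    rw [integral_finsetSum _ fun j _ => (hY j).integrable one_le_two]
    simp [hY0]
  rw [variance_of_integral_eq_zero hs.aemeasurable hs0] at h
  simp only [Finset.sum_apply] at h
  rw [h]
  refine Finset.sum_congr rfl fun j _ => ?_
  rw [variance_of_integral_eq_zero (hY j).aemeasurable (hY0 j), ← integral_const_mul]
  simp [mul_pow]

/-- Conditional Jensen for `t ↦ t ^ 2`. -/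
theorem submartingale_sq_of_martingale {F : Filtration ℕ ‹MeasurableSpace Ω›} {f : ℕ → Ω → ℝ}
    (hf : Martingale f F P) (hL2 : ∀ k, MemLp (f k) 2 P) :
    Submartingale (fun k w => f k w ^ 2) F P := by
  refine submartingale_nat (fun k => (hf.1 k).pow 2) (fun k => (hL2 k).integrable_sq) fun k => ?_
  have h := ConvexOn.map_condExp_le_univ (μ := P) (F.le k) (even_two.convexOn_pow (𝕜 := ℝ))
    (by fun_prop : Continuous fun t : ℝ => t ^ 2).lowerSemicontinuous
    ((hL2 (k + 1)).integrable one_le_two) (hL2 (k + 1)).integrable_sq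
  filter_upwards [h, hf.2 k (k + 1) k.le_succ] with w h1 h2
  rw [Function.comp_apply, h2] at h1
  exact h1

/-- If the tails of the running maximum of `f` decay quadratically, the supremum is dominated by an
integrable function. -/
theorem exists_integrable_bound_of_maximal {f : ℕ → Ω → ℝ} (hf : ∀ k, Measurable (f k)) {V : ℝ}
    (h : ∀ m : ℕ, ∀ n : ℕ, (m : ℝ≥0∞) ^ 2 * P {w | ∃ k ≤ n, (m : ℝ) ≤ |f k w|}
      ≤ ENNReal.ofReal V) :
    ∃ M : Ω → ℝ, Integrable M P ∧ ∀ᵐ w ∂P, ∀ k, |f k w| ≤ M w := by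
  set E : ℕ → Set Ω := fun m => {w | ∃ k, (m : ℝ) ≤ |f k w|}
  have hEm : ∀ m, MeasurableSet (E m) := fun m => by
    have : E m = ⋃ k, {w | (m : ℝ) ≤ |f k w|} := by ext; simp [E]
    rw [this]
    exact MeasurableSet.iUnion fun k => measurableSet_le measurable_const (hf k).abs
  have hE : ∀ m : ℕ, (m : ℝ≥0∞) ^ 2 * P (E m) ≤ ENNReal.ofReal V := by
    intro m
    have hU : E m = ⋃ n, {w | ∃ k ≤ n, (m : ℝ) ≤ |f k w|} := by
      ext w
      simp only [E, Set.mem_ofPred_eq, Set.mem_iUnion]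
      exact ⟨fun ⟨k, hk⟩ => ⟨k, k, le_rfl, hk⟩, fun ⟨_, k, _, hk⟩ => ⟨k, hk⟩⟩
    have hmono : Monotone fun n : ℕ => {w | ∃ k ≤ n, (m : ℝ) ≤ |f k w|} :=
      fun n n' hn w ⟨k, hk, hw⟩ => ⟨k, hk.trans hn, hw⟩
    rw [hU, hmono.measure_iUnion, ENNReal.mul_iSup]
    exact iSup_le fun n => h m n
  -- Layer-cake: `Q` dominates `1 + ⌊|f k|⌋` for every `k`, and its expectation is at most `1 + ∑ V
  -- / (m + 1)²`.
  set Q : Ω → ℝ≥0∞ := fun w => 1 + ∑' m : ℕ, (E (m + 1)).indicator 1 w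
  have hQm : Measurable Q := by
    have hm : ∀ m : ℕ, Measurable ((E (m + 1)).indicator (1 : Ω → ℝ≥0∞)) := fun m =>
      measurable_one.indicator (hEm _)
    fun_prop
  have hsum : ∑' m : ℕ, P (E (m + 1)) < ∞ := by
    have hb : ∀ m : ℕ, P (E (m + 1)) ≤ ENNReal.ofReal (V * (1 / ((m + 1 : ℕ) : ℝ) ^ 2)) := by
      intro m
      have h1 := hE (m + 1)
      have h2 : (0 : ℝ) < ((m + 1 : ℕ) : ℝ) ^ 2 := by positivity
      rw [mul_one_div, ENNReal.ofReal_div_of_pos h2, ENNReal.ofReal_pow (by positivity),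
        ENNReal.ofReal_natCast]
      rw [ENNReal.le_div_iff_mul_le (Or.inl (by positivity)) (Or.inl (by finiteness)), mul_comm]
      exact h1
    refine (ENNReal.tsum_le_tsum hb).trans_lt ?_
    have : Summable fun m : ℕ => V * (1 / ((m + 1 : ℕ) : ℝ) ^ 2) :=
      (((summable_nat_add_iff 1).2 (Real.summable_one_div_nat_pow.2 one_lt_two))).mul_left V
    exact this.tsum_ofReal_lt_top
  have hQi : ∫⁻ w, Q w ∂P ≠ ∞ := by
    rw [lintegral_add_left measurable_const, lintegral_tsum fun m =>
      (measurable_one.indicator (hEm _)).aemeasurable]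
    simp only [lintegral_indicator_one (hEm _), lintegral_const, measure_univ, one_mul]
    exact (ENNReal.add_lt_top.2 ⟨ENNReal.one_lt_top, hsum⟩).ne
  refine ⟨fun w => (Q w).toReal, integrable_toReal_of_lintegral_ne_top hQm.aemeasurable hQi, ?_⟩
  filter_upwards [ae_lt_top hQm hQi] with w hw k
  rw [← ENNReal.ofReal_le_iff_le_toReal hw.ne]
  have hfl : |f k w| ≤ (1 : ℝ) + ⌊|f k w|⌋₊ := by
    rw [add_comm]; exact (Nat.lt_floor_add_one _).le
  refine (ENNReal.ofReal_le_ofReal hfl).trans ?_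
  rw [ENNReal.ofReal_add zero_le_one (by positivity), ENNReal.ofReal_one, ENNReal.ofReal_natCast]
  refine add_le_add_right ?_ 1
  calc ((⌊|f k w|⌋₊ : ℕ) : ℝ≥0∞)
      = ∑ m ∈ Finset.range ⌊|f k w|⌋₊, (E (m + 1)).indicator 1 w := by
        rw [Finset.sum_congr rfl fun m hm => Set.indicator_of_mem (f := (1 : Ω → ℝ≥0∞)) ?_]
        · simp
        · refine ⟨k, (Nat.le_floor_iff (abs_nonneg _)).1 ?_⟩
          simpa using hm
    _ ≤ _ := ENNReal.sum_le_tsum _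

/-- An `L²`-bounded martingale converges almost surely and is dominated by an integrable
function. -/
theorem martingale_ae_tendsto_and_exists_bound {F : Filtration ℕ ‹MeasurableSpace Ω›}
    {f : ℕ → Ω → ℝ} (hf : Martingale f F P) (hL2 : ∀ k, MemLp (f k) 2 P) {V : ℝ}
    (hV : ∀ k, ∫ w, f k w ^ 2 ∂P ≤ V) :
    (∀ᵐ w ∂P, ∃ c, Tendsto (fun k => f k w) atTop (𝓝 c)) ∧
      ∃ M : Ω → ℝ, Integrable M P ∧ ∀ᵐ w ∂P, ∀ k, |f k w| ≤ M w := by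
  constructor
  · refine hf.submartingale.exists_ae_tendsto_of_bdd (R := Real.toNNReal (1 + V)) fun k => ?_
    rw [eLpNorm_one_eq_lintegral_enorm,
      ← ofReal_integral_norm_eq_lintegral_enorm (hf.integrable k)]
    refine ENNReal.ofReal_le_ofReal ?_
    calc ∫ w, ‖f k w‖ ∂P ≤ ∫ w, (1 + f k w ^ 2) ∂P := by
          refine integral_mono (hf.integrable k).norm
            ((integrable_const _).add (hL2 k).integrable_sq) fun w => ?_
          rw [Real.norm_eq_abs]
          nlinarith [sq_nonneg (|f k w| - 1), sq_abs (f k w)]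
      _ = 1 + ∫ w, f k w ^ 2 ∂P := by
          rw [integral_add (integrable_const _) (hL2 k).integrable_sq]; simp
      _ ≤ 1 + V := by linarith [hV k]
  · refine exists_integrable_bound_of_maximal (V := V)
      (fun k => (hf.1 k).measurable.mono (F.le k) le_rfl) fun m n => ?_
    -- Doob's inequality for `f²` at level `m²` yields the quadratic tail.
    have h := maximal_ineq (submartingale_sq_of_martingale hf hL2) (fun k w => sq_nonneg (f k w))
      (ε := (m : ℝ≥0) ^ 2) n
    have e : {w | ∃ k ≤ n, (m : ℝ) ≤ |f k w|} = {w | (((m : ℝ≥0) ^ 2 : ℝ≥0) : ℝ) ≤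
        (Finset.range (n + 1)).sup' Finset.nonempty_range_add_one fun k => f k w ^ 2} := by
      ext w
      simp only [Set.mem_ofPred_eq, Finset.le_sup'_iff, Finset.mem_range, Nat.lt_succ_iff]
      refine exists_congr fun k => and_congr_right fun _ => ?_
      rw [← sq_abs (f k w)]
      push_cast
      exact (pow_le_pow_iff_left₀ (by positivity) (abs_nonneg _) two_ne_zero).symm
    rw [e]
    push_cast at h ⊢
    refine h.trans (ENNReal.ofReal_le_ofReal ?_)
    refine (setIntegral_le_integral (hL2 n).integrable_sq ?_).trans (hV n)
    exact ae_of_all _ fun w => sq_nonneg _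

/-- Weighted sums of independent centred variables with bounded variances and square-summable
weights converge almost surely and are dominated by an integrable function. -/
theorem weighted_sum_ae_tendsto_and_exists_bound (hL2 : ∀ i, MemLp (X i) 2 P)
    (hind : iIndepFun X P) (hmean : ∀ i, ∫ w, X i w ∂P = 0) {C : ℝ}
    (hC : ∀ i, ∫ w, X i w ^ 2 ∂P ≤ C) (ha : Summable fun i => a i ^ 2) :
    (∀ᵐ w ∂P, ∃ c, Tendsto (fun k => ∑ j ∈ Finset.range k, a j * X j w) atTop (𝓝 c)) ∧
      ∃ M : Ω → ℝ, Integrable M P ∧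
        ∀ᵐ w ∂P, ∀ k, |∑ j ∈ Finset.range k, a j * X j w| ≤ M w := by
  -- The natural filtration needs strongly measurable versions.
  set Y : ℕ → Ω → ℝ := fun i => (hL2 i).1.mk (X i)
  have hY : ∀ i, StronglyMeasurable (Y i) := fun i => (hL2 i).1.stronglyMeasurable_mk
  have hXY : ∀ i, X i =ᵐ[P] Y i := fun i => (hL2 i).1.ae_eq_mk
  have hYL2 : ∀ i, MemLp (Y i) 2 P := fun i => (hL2 i).ae_eq (hXY i)
  have hYind : iIndepFun Y P := hind.congr hXY
  have hYmean : ∀ i, ∫ w, Y i w ∂P = 0 := fun i => by rw [← integral_congr_ae (hXY i), hmean]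
  have hYC : ∀ i, ∫ w, Y i w ^ 2 ∂P ≤ C := fun i => by
    refine (integral_congr_ae ((hXY i).mono fun w h => ?_)).trans_le (hC i)
    exact congrArg (· ^ 2) h.symm
  have hC0 : 0 ≤ C := (integral_nonneg fun w => sq_nonneg (X 0 w)).trans (hC 0)
  have hmart := martingale_weighted_sum hY hYind (fun i => (hYL2 i).integrable one_le_two)
    hYmean a
  obtain ⟨h1, M, hM, h2⟩ := martingale_ae_tendsto_and_exists_bound hmart
    (fun k => memLp_finsetSum _ fun j _ => (hYL2 j).const_mul _)
    (V := (∑' i, a i ^ 2) * C) fun k => by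
      rw [integral_weighted_sum_sq hYL2 hYind hYmean]
      refine (Finset.sum_le_sum fun j _ =>
        mul_le_mul_of_nonneg_left (hYC j) (sq_nonneg (a j))).trans ?_
      rw [← Finset.sum_mul]
      exact mul_le_mul_of_nonneg_right (ha.sum_le_tsum _ fun i _ => sq_nonneg _) hC0
  have hall : ∀ᵐ w ∂P, ∀ i, X i w = Y i w := ae_all_iff.2 hXY
  refine ⟨?_, M, hM, ?_⟩
  · filter_upwards [h1, hall] with w ⟨c, hc⟩ h
    refine ⟨c, (tendsto_add_atTop_iff_nat 1).1 ?_⟩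
    simpa only [h] using hc
  · filter_upwards [h2, hall] with w h2 h k
    simp only [h]
    cases k with
    | zero => simpa using (abs_nonneg _).trans (h2 0)
    | succ k => exact h2 k

end Martingale

/-! ### Measurability of the states and the limit of expectations -/

theorem measurable_step : Measurable step :=
  Measurable.ite measurableSet_Ici measurable_const measurable_const

theorem aemeasurable_state {N : ℕ} (G : SimpleGraph (Fin N)) [DecidableRel G.Adj]
    (x : Fin N → ℝ) (p : ℝ) (α η : ℕ → ℝ) {Ω : Type*} [MeasurableSpace Ω] {P : Measure Ω}
    {ξ : Fin N → Fin N → ℕ → Ω → ℝ}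
    (hξ : ∀ n l, G.Adj n l → ∀ i, AEMeasurable (ξ n l i) P) (i : ℕ) (n : Fin N) :
    AEMeasurable (fun w => state G x p α η (fun n l i => ξ n l i w) i n) P := by
  induction i generalizing n with
  | zero => exact aemeasurable_const
  | succ i ih =>
    have hl : ∀ n, AEMeasurable (fun w => localUpdate x p (α i)
        (state G x p α η (fun n l i => ξ n l i w) i) n) P := fun n =>
      (ih n).sub (((measurable_step.comp_aemeasurable ((ih n).sub_const _)).sub_const _).const_mul _)
    refine (hl n).sub (AEMeasurable.const_mul ?_ _)
    refine Finset.aemeasurable_fun_sum _ fun l h => (hl n).sub ((hl l).add (hξ n l ?_ i))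
    simpa using h

end DistQuantile

theorem theorem1 {N : ℕ} (G : SimpleGraph (Fin N)) [DecidableRel G.Adj] (hG : G.Connected)
    (x : Fin N → ℝ)
    (p : ℝ) (hp0 : 0 < p) (hp1 : p < 1) (hp : ∀ k ∈ Finset.Icc 1 N, p ≠ (k : ℝ) / (N : ℝ))
    (α₀ η₀ τ₁ τ₂ : ℝ) (hα₀ : 0 < α₀) (hη₀ : 0 < η₀)
    (hτ₁ : τ₁ ≤ 1) (hτ : τ₂ < τ₁) (hτ₂ : 1 / 2 < τ₂) (hτd : τ₁ - τ₂ < 1 / 2)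
    {Ω : Type*} [MeasurableSpace Ω] (P : Measure Ω) [IsProbabilityMeasure P]
    (ξ : Fin N → Fin N → ℕ → Ω → ℝ)
    (hindep : ∀ n l, G.Adj n l → iIndepFun (ξ n l) P)
    (hident : ∀ n l, G.Adj n l → ∀ i j, IdentDistrib (ξ n l i) (ξ n l j) P P)
    (hL2 : ∀ n l, G.Adj n l → ∀ i, MemLp (ξ n l i) 2 P)
    (hmean : ∀ n l, G.Adj n l → ∀ i, ∫ w, ξ n l i w ∂P = 0)
    (hvar : ∃ C : ℝ, ∀ n l, G.Adj n l → ∀ i, ∫ w, (ξ n l i w) ^ 2 ∂P ≤ C)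
    (ω : ℕ → Fin N → Ω → ℝ)
    (hω : ∀ i n w, ω i n w = DistQuantile.state G x p (DistQuantile.stepSize α₀ τ₁)
      (DistQuantile.stepSize η₀ τ₂) (fun n l i => ξ n l i w) i n) :
    ∀ n, (∀ i, Integrable (ω i n) P) ∧
      Tendsto (fun i => ∫ w, ω i n w ∂P) atTop (𝓝 (DistQuantile.quantile x p)) := by
  have hτ₂0 : 0 < τ₂ := by linarith
  have hα : ∀ i, 0 ≤ DistQuantile.stepSize α₀ τ₁ i := fun i =>
    (DistQuantile.stepSize_pos hα₀ τ₁ i).le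
  have hη := DistQuantile.stepSize_pos hη₀ τ₂
  have hα0 := DistQuantile.tendsto_stepSize α₀ (hτ₂0.trans hτ)
  have hη0 := DistQuantile.tendsto_stepSize η₀ hτ₂0
  have hαη : Tendsto (fun i => DistQuantile.stepSize α₀ τ₁ i / DistQuantile.stepSize η₀ τ₂ i)
      atTop (𝓝 0) := by
    simp_rw [DistQuantile.stepSize_div]
    exact DistQuantile.tendsto_stepSize _ (sub_pos.2 hτ)
  obtain ⟨C, hC⟩ := hvar
  have hlink : ∀ n l, ∃ M : Ω → ℝ, Integrable M P ∧ (G.Adj n l → ∀ᵐ w ∂P,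
      (∃ c, Tendsto (fun k => ∑ j ∈ Finset.range k,
        DistQuantile.stepSize η₀ τ₂ j * ξ n l j w) atTop (𝓝 c)) ∧
      ∀ k, |∑ j ∈ Finset.range k, DistQuantile.stepSize η₀ τ₂ j * ξ n l j w| ≤ M w) := by
    intro n l
    by_cases h : G.Adj n l
    · obtain ⟨h1, M, hM, h2⟩ := DistQuantile.weighted_sum_ae_tendsto_and_exists_bound (hL2 n l h)
        (hindep n l h) (hmean n l h) (hC n l h) (DistQuantile.summable_stepSize_sq hη₀ hτ₂)
      exact ⟨M, hM, fun _ => h1.and h2⟩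
    · exact ⟨0, integrable_zero _ _ _, fun h' => absurd h' h⟩
  choose M hM hlink using hlink
  have hae : ∀ᵐ w ∂P, ∀ n l, G.Adj n l →
      (∃ c, Tendsto (fun k => ∑ j ∈ Finset.range k,
        DistQuantile.stepSize η₀ τ₂ j * ξ n l j w) atTop (𝓝 c)) ∧
      ∀ k, |∑ j ∈ Finset.range k, DistQuantile.stepSize η₀ τ₂ j * ξ n l j w| ≤ M n l w := by
    simp only [ae_all_iff]
    exact hlink
  -- Absolute values make `B` nonnegative everywhere and at least each `M n l`.
  set B : Ω → ℝ := fun w => ∑ n, ∑ l, |M n l w|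
  have hB : Integrable B P :=
    integrable_finsetSum _ fun n _ => integrable_finsetSum _ fun l _ => (hM n l).abs
  obtain ⟨K, hK⟩ := DistQuantile.exists_abs_state_le hG x hp0 hp1 hα hη hα0 hη0 hαη
  have hωeq : ∀ i n, ω i n = fun w => DistQuantile.state G x p (DistQuantile.stepSize α₀ τ₁)
      (DistQuantile.stepSize η₀ τ₂) (fun n l i => ξ n l i w) i n := fun i n => funext (hω i n)
  have hmeas : ∀ i n, AEStronglyMeasurable (ω i n) P := fun i n => by
    rw [hωeq]
    exact (DistQuantile.aemeasurable_state G x p _ _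
      (fun n l h i => (hL2 n l h i).1.aemeasurable) i n).aestronglyMeasurable
  have hbound : ∀ i n, ∀ᵐ w ∂P, ‖ω i n w‖ ≤ K * (1 + B w) := by
    intro i n
    filter_upwards [hae] with w hw
    rw [hω, Real.norm_eq_abs]
    refine hK _ _ (by positivity) (fun n l h k => ((hw n l h).2 k).trans ?_) i n
    exact (le_abs_self _).trans ((Finset.single_le_sum (f := fun l => |M n l w|)
      (fun l _ => abs_nonneg _) (Finset.mem_univ l)).trans
      (Finset.single_le_sum (f := fun n => ∑ l, |M n l w|)
        (fun n _ => by positivity) (Finset.mem_univ n)))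
  have hdom : Integrable (fun w => K * (1 + B w)) P := ((integrable_const 1).add hB).const_mul K
  intro n
  refine ⟨fun i => hdom.mono' (hmeas i n) (hbound i n), ?_⟩
  have hlim := tendsto_integral_of_dominated_convergence (F := fun i => ω i n)
    (f := fun _ => DistQuantile.quantile x p) (fun w => K * (1 + B w)) (fun i => hmeas i n) hdom
    (fun i => hbound i n) (by
      filter_upwards [hae] with w hw
      simp only [hω]
      exact DistQuantile.tendsto_state hG hp0 hp1 hp hα hη hα0 hη0 hαη
        (DistQuantile.tendsto_sum_stepSize hα₀ hτ₁)
        (DistQuantile.tendsto_sum_stepSize hη₀ (hτ.le.trans hτ₁))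
        (fun n l h => (hw n l h).1) n)
  simpa using hlim
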